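/- Let $\varphi_n$ be the $n$-th partial recursive function and $\langle m,n\rangle$ a computable pairing on $\mathbb N$. For $A,B\subseteq\mathbb N$ put $A\wedge B=\{\langle m,n\rangle: m\in A,n\in B\}$, $A\vee B=\{\langle 0,n\rangle:n\in A\}\cup\{\langle 1,n\rangle:n\in B\}$, $A\Rightarrow B=\{n:\forall m\in A,\ \varphi_n(m)\text{ is defined and lies in }B\}$. An object $X$ of the effective topos $\mathsf{Eff}$ is a set $|X|$ with an equality predicate $[x=_Xy]\subseteq\mathbb N$ that is (uniformly realizably) symmetric and transitive; $E_X(x)=[x=_Xx]$; morphisms are functional relations up to mutual entailment; formulas of the internal language are interpreted as usual, with $\forall x{:}X.\,\phi(x)$ interpreted by $\bigcap_{x}(E_X(x)\Rightarrow\phi(x))$ and $\exists x{:}X.\,\phi(x)$ by $\bigcup_x(E_X(x)\wedge\phi(x))$, and a closed formula is valid when its interpretation is non-empty. Let $\mathcal P(X)$ denote the powerobject, $X^Y$ the exponential, and $\nabla\mathsf 2$ the constant object on $\mathsf 2=\{0,1\}$: $[p=_{\nabla\mathsf 2}q]=\mathbb N$ if $p=q$ and $\emptyset$ otherwise. **Proposition.**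 Let $L$ be an object of $\mathsf{Eff}$ with a relation $\le$ on it (represented by a strict extensional predicate on $|L|\times|L|$) which is reflexive, transitive and antisymmetric in the internal language of $\mathsf{Eff}$. Define the following subobjects of $\mathcal P(L)$ in the internal language: $$\mathsf{Ch}(L)=\{C\in\mathcal P(L)\mid \forall x,y{:}L.\ x\in C\wedge y\in C\Rightarrow x\le y\vee y\le x\},$$ $$\mathsf{Disc}(L)=\{A\in\mathcal P(L)\mid \forall f{:}L^{\nabla\mathsf 2}.\ (\forall p{:}\nabla\mathsf 2.\ f(p)\in A)\Rightarrow(\forall p{:}\nabla\mathsf 2.\ f(p)=f(1))\}.$$ Then every chain is discrete: the statement $\forall C{:}\mathcal P(L).\ C\in\mathsf{Ch}(L)\Rightarrow C\in\mathsf{Disc}(L)$ is valid in $\mathsf{Eff}$, that is, $\mathsf{Ch}(L)\subseteq\mathsf{Disc}(L)$ as subobjects of $\mathcal P(L)$. -/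

import Mathlib

universe u

/-! ## Non-standard propositions and predicates

A non-standard proposition is a set of natural numbers (its realizers); a non-standard predicate
on a type `X` is a map `X → Set ℕ`. Formulas with free variables are written as Lean expressions of
type `Set ℕ` depending on those variables. -/

namespace Realizability

open Nat.Partrec (Code)

/-- The result (possibly undefined) of the `n`-th partial recursive function at `m`. -/
def app (n m : ℕ) : Part ℕ := (Denumerable.ofNat Code n).eval m

/-- Conjunction. -/
def conj (A B : Set ℕ) : Set ℕ := {k | ∃ m ∈ A, ∃ n ∈ B, k = Nat.pair m n}

/-- Disjunction. -/
def disj (A B : Set ℕ) : Set ℕ :=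
  {k | ∃ n ∈ A, k = Nat.pair 0 n} ∪ {k | ∃ n ∈ B, k = Nat.pair 1 n}

/-- Implication. -/
def imp (A B : Set ℕ) : Set ℕ := {n | ∀ m ∈ A, ∃ r ∈ app n m, r ∈ B}

infixr:70 " ⊓ᵣ " => conj
infixr:66 " ⊔ᵣ " => disj
infixr:62 " ⇒ᵣ " => imp

/-- A closed non-standard proposition is valid when it has a realizer. A predicate
`A : X → Set ℕ` is valid when `⋂ x, A x` is, that is, when it has a uniform realizer. -/
def Valid (A : Set ℕ) : Prop := A.Nonempty

/-- Entailment of predicates over the same type: one program turns realizers of `A i` into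
realizers of `B i`, uniformly in `i`. -/
def Entails {ι : Type*} (A B : ι → Set ℕ) : Prop := Valid (⋂ i, A i ⇒ᵣ B i)

/-! ### A small natural-deduction calculus for uniform validity -/

/-- The conjunction of a list of hypotheses. -/
def ctx : List (Set ℕ) → Set ℕ
  | [] => Set.univ
  | A :: Γ => A ⊓ᵣ ctx Γ

/-- `A i` follows from the hypotheses `Γ i`, uniformly in `i`. -/
def Der {ι : Type*} (Γ : ι → List (Set ℕ)) (A : ι → Set ℕ) : Prop :=
  Entails (fun i => ctx (Γ i)) A

theorem entails_of_partrec {ι : Type*} {A B : ι → Set ℕ} (f : ℕ →. ℕ) (hf : Nat.Partrec f)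
    (h : ∀ i, ∀ m ∈ A i, ∃ r ∈ f m, r ∈ B i) : Entails A B := by
  obtain ⟨c, rfl⟩ := Code.exists_code.1 hf
  refine ⟨Encodable.encode c, Set.mem_iInter.2 fun i m hm => ?_⟩
  simpa [app] using h i m hm

theorem Entails.exists_code {ι : Type*} {A B : ι → Set ℕ} (h : Entails A B) :
    ∃ c : Code, ∀ i, ∀ m ∈ A i, ∃ r ∈ c.eval m, r ∈ B i := by
  obtain ⟨n, hn⟩ := h
  exact ⟨Denumerable.ofNat Code n, fun i m hm => Set.mem_iInter.1 hn i m hm⟩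

theorem entails_of_code {ι : Type*} {A B : ι → Set ℕ} (c : Code)
    (h : ∀ i, ∀ m ∈ A i, ∃ r ∈ c.eval m, r ∈ B i) : Entails A B :=
  entails_of_partrec c.eval (Code.exists_code.2 ⟨c, rfl⟩) h

theorem app_partrec₂ : Partrec₂ app :=
  (Code.eval_part.comp ((Computable.ofNat Code).comp Computable.fst) Computable.snd).to₂

theorem Entails.trans {ι : Type*} {A B C : ι → Set ℕ} (h₁ : Entails A B) (h₂ : Entails B C) :
    Entails A C := by
  obtain ⟨c, hc⟩ := h₁.exists_code
  obtain ⟨d, hd⟩ := h₂.exists_code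
  refine entails_of_code (d.comp c) fun i m hm => ?_
  obtain ⟨r, hr, hrB⟩ := hc i m hm
  obtain ⟨s, hs, hsC⟩ := hd i r hrB
  exact ⟨s, Part.mem_bind_iff.2 ⟨r, hr, hs⟩, hsC⟩

theorem Entails.of_subset {ι : Type*} {A B : ι → Set ℕ} (h : ∀ i, A i ⊆ B i) : Entails A B :=
  entails_of_code Code.id fun i m hm => ⟨m, by simp, h i hm⟩

theorem conj_fst {ι : Type*} {A B : ι → Set ℕ} : Entails (fun i => A i ⊓ᵣ B i) A := by
  refine entails_of_code Code.left fun i m hm => ?_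
  obtain ⟨a, ha, b, hb, rfl⟩ := hm
  exact ⟨a, by simp [Code.eval], ha⟩

theorem conj_snd {ι : Type*} {A B : ι → Set ℕ} : Entails (fun i => A i ⊓ᵣ B i) B := by
  refine entails_of_code Code.right fun i m hm => ?_
  obtain ⟨a, ha, b, hb, rfl⟩ := hm
  exact ⟨b, by simp [Code.eval], hb⟩

theorem Entails.conj {ι : Type*} {A B C : ι → Set ℕ} (h₁ : Entails A B) (h₂ : Entails A C) :
    Entails A (fun i => B i ⊓ᵣ C i) := by
  obtain ⟨c, hc⟩ := h₁.exists_code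
  obtain ⟨d, hd⟩ := h₂.exists_code
  refine entails_of_code (c.pair d) fun i m hm => ?_
  obtain ⟨r, hr, hrB⟩ := hc i m hm
  obtain ⟨s, hs, hsC⟩ := hd i m hm
  refine ⟨Nat.pair r s, ?_, r, hrB, s, hsC, rfl⟩
  rw [Part.eq_some_iff.2 hr |> fun h => show (c.pair d).eval m = _ by
    simp only [Code.eval, h, Part.eq_some_iff.2 hs]; rfl]
  simp [Seq.seq]

theorem Entails.curry {ι : Type*} {A B C : ι → Set ℕ}
    (h : Entails (fun i => A i ⊓ᵣ B i) C) : Entails A (fun i => B i ⇒ᵣ C i) := by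
  obtain ⟨c, hc⟩ := h.exists_code
  have hcomp : Computable fun m : ℕ => Encodable.encode (c.curry m) :=
    Computable.encode.comp
      (Code.primrec₂_curry.to_comp.comp (Computable.const c) Computable.id)
  refine entails_of_partrec (fun m : ℕ => Part.some (Encodable.encode (c.curry m)))
    (Partrec.nat_iff.1 hcomp.partrec) fun i m hm => ⟨_, Part.mem_some _, fun b hb => ?_⟩
  obtain ⟨r, hr, hrC⟩ := hc i (Nat.pair m b) ⟨m, hm, b, hb, rfl⟩
  exact ⟨r, by simpa [app] using hr, hrC⟩

theorem Entails.mp {ι : Type*} {A B C : ι → Set ℕ} (h₁ : Entails A (fun i => B i ⇒ᵣ C i))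
    (h₂ : Entails A B) : Entails A C := by
  obtain ⟨c, hc⟩ := h₁.exists_code
  obtain ⟨d, hd⟩ := h₂.exists_code
  have hp (c : Code) : Partrec c.eval := Partrec.nat_iff.2 (Code.exists_code.2 ⟨c, rfl⟩)
  refine entails_of_partrec (fun m => (c.eval m).bind fun a => (d.eval m).bind fun b => app a b)
    (Partrec.nat_iff.1 ?_) fun i m hm => ?_
  · exact (hp c).bind (((hp d).comp Computable.fst).bind
      (app_partrec₂.comp (Computable.snd.comp Computable.fst) Computable.snd).to₂).to₂
  · obtain ⟨a, ha, haB⟩ := hc i m hm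
    obtain ⟨b, hb, hbB⟩ := hd i m hm
    obtain ⟨r, hr, hrC⟩ := haB b hbB
    exact ⟨r, by simpa using ⟨a, ha, b, hb, hr⟩, hrC⟩

namespace Der

variable {ι κ : Type*} {Γ : ι → List (Set ℕ)} {A B C D E F : ι → Set ℕ}

theorem h0 : Der (fun i => A i :: Γ i) A := conj_fst

theorem wk (h : Der Γ A) : Der (fun i => B i :: Γ i) A := Entails.trans conj_snd h

theorem h1 : Der (fun i => B i :: A i :: Γ i) A := wk h0

theorem h2 : Der (fun i => C i :: B i :: A i :: Γ i) A := wk h1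

theorem h3 : Der (fun i => D i :: C i :: B i :: A i :: Γ i) A := wk h2

theorem h4 : Der (fun i => E i :: D i :: C i :: B i :: A i :: Γ i) A := wk h3

theorem andI (h₁ : Der Γ A) (h₂ : Der Γ B) : Der Γ (fun i => A i ⊓ᵣ B i) := Entails.conj h₁ h₂

theorem fst (h : Der Γ (fun i => A i ⊓ᵣ B i)) : Der Γ A := Entails.trans h conj_fst

theorem snd (h : Der Γ (fun i => A i ⊓ᵣ B i)) : Der Γ B := Entails.trans h conj_snd

theorem impI (h : Der (fun i => A i :: Γ i) B) : Der Γ (fun i => A i ⇒ᵣ B i) :=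
  Entails.curry (Entails.trans (Entails.conj conj_snd conj_fst) h)

theorem mp (h : Der Γ (fun i => A i ⇒ᵣ B i)) (h' : Der Γ A) : Der Γ B := Entails.mp h h'

theorem cut (h : Der Γ A) (h' : Der (fun i => A i :: Γ i) B) : Der Γ B := mp (impI h') h

theorem reindex (h : Der Γ A) (k : κ → ι) : Der (fun j => Γ (k j)) (fun j => A (k j)) := by
  obtain ⟨n, hn⟩ := h
  exact ⟨n, Set.mem_iInter.2 fun j => Set.mem_iInter.1 hn (k j)⟩

theorem allI {B : ι → κ → Set ℕ} (h : Der (fun p : ι × κ => Γ p.1) (fun p => B p.1 p.2)) :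
    Der Γ (fun i => ⋂ k, B i k) := by
  obtain ⟨c, hc⟩ := h.exists_code
  by_cases hκ : Nonempty κ
  · refine entails_of_code c fun i m hm => ?_
    obtain ⟨k₀⟩ := hκ
    obtain ⟨r, hr, -⟩ := hc (i, k₀) m hm
    refine ⟨r, hr, Set.mem_iInter.2 fun k => ?_⟩
    obtain ⟨s, hs, hsB⟩ := hc (i, k) m hm
    exact Part.mem_unique hs hr ▸ hsB
  · refine entails_of_code Code.id fun i m hm => ⟨m, by simp, Set.mem_iInter.2 fun k => ?_⟩
    exact (hκ ⟨k⟩).elim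

theorem allE {B : ι → κ → Set ℕ} (h : Der Γ (fun i => ⋂ k, B i k)) (k : ι → κ) :
    Der Γ (fun i => B i (k i)) :=
  Entails.trans h (Entails.of_subset fun i => Set.iInter_subset (B i) (k i))

theorem exI {B : ι → κ → Set ℕ} (k : ι → κ) (h : Der Γ (fun i => B i (k i))) :
    Der Γ (fun i => ⋃ k, B i k) :=
  Entails.trans h (Entails.of_subset fun i => Set.subset_iUnion (B i) (k i))

theorem exE {B : ι → κ → Set ℕ} (h : Der Γ (fun i => ⋃ k, B i k))
    (h' : Der (fun p : ι × κ => B p.1 p.2 :: Γ p.1) (fun p => C p.1)) : Der Γ C := by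
  refine cut h ?_
  obtain ⟨c, hc⟩ := h'.exists_code
  refine entails_of_code c fun i m hm => ?_
  obtain ⟨a, ha, b, hb, rfl⟩ := hm
  obtain ⟨k, hk⟩ := Set.mem_iUnion.1 ha
  exact hc (i, k) _ ⟨a, hk, b, hb, rfl⟩

theorem ofValid {P : Set ℕ} (h : Valid P) : Der Γ (fun _ => P) := by
  obtain ⟨n, hn⟩ := h
  exact entails_of_code (Code.const n) fun i m _ => ⟨n, by simp, hn⟩

theorem valid {P : Set ℕ} (h : Der (fun _ : Unit => []) (fun _ => P)) : Valid P := by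
  obtain ⟨c, hc⟩ := h.exists_code
  obtain ⟨r, -, hr⟩ := hc () 0 trivial
  exact ⟨r, hr⟩

end Der

theorem entails_iff_der {ι : Type*} {A B : ι → Set ℕ} :
    Entails A B ↔ Der (fun i => [A i]) B :=
  ⟨fun h => Entails.trans conj_fst h, fun h => Entails.trans
    (Entails.conj (Entails.of_subset fun _ => subset_rfl)
      (Entails.of_subset fun _ => Set.subset_univ _)) h⟩

end Realizability

open Realizability

/-! ## The effective topos -/

/-- An object of the effective topos: a set with a non-standard equality predicate that is
symmetric and transitive. -/
structure Eff : Type (u + 1) where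
  carrier : Type u
  eq : carrier → carrier → Set ℕ
  symm : Valid (⋂ x, ⋂ y, eq x y ⇒ᵣ eq y x)
  trans : Valid (⋂ x, ⋂ y, ⋂ z, eq x y ⊓ᵣ eq y z ⇒ᵣ eq x z)

namespace Eff

/-- The existence predicate. -/
def ex (X : Eff.{u}) (x : X.carrier) : Set ℕ := X.eq x x

/-- The interpretation of the quantifier `∀ x : X`. -/
def all (X : Eff.{u}) (φ : X.carrier → Set ℕ) : Set ℕ := ⋂ x, X.ex x ⇒ᵣ φ x

/-- The interpretation of the quantifier `∃ x : X`. -/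
def some (X : Eff.{u}) (φ : X.carrier → Set ℕ) : Set ℕ := ⋃ x, X.ex x ⊓ᵣ φ x

/-! ### Strict extensional predicates and functional relations -/

/-- `A` is a strict predicate on `X`. -/
def strictPred (X : Eff.{u}) (A : X.carrier → Set ℕ) : Set ℕ := ⋂ x, A x ⇒ᵣ X.ex x

/-- `A` is an extensional predicate on `X`. -/
def extPred (X : Eff.{u}) (A : X.carrier → Set ℕ) : Set ℕ :=
  ⋂ x, ⋂ y, A x ⊓ᵣ X.eq x y ⇒ᵣ A y

/-- `F` is a strict relation between `X` and `Y`. -/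
def strictRel (X Y : Eff.{u}) (F : X.carrier → Y.carrier → Set ℕ) : Set ℕ :=
  ⋂ x, ⋂ y, F x y ⇒ᵣ X.ex x ⊓ᵣ Y.ex y

/-- `F` is an extensional relation between `X` and `Y`. -/
def extRel (X Y : Eff.{u}) (F : X.carrier → Y.carrier → Set ℕ) : Set ℕ :=
  ⋂ x', ⋂ x, ⋂ y, ⋂ y', X.eq x' x ⊓ᵣ F x y ⊓ᵣ Y.eq y y' ⇒ᵣ F x' y'

/-- `F` is single-valued. -/
def singleValued (X Y : Eff.{u}) (F : X.carrier → Y.carrier → Set ℕ) : Set ℕ :=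
  ⋂ x, ⋂ y, ⋂ y', F x y ⊓ᵣ F x y' ⇒ᵣ Y.eq y y'

/-- `F` is total. -/
def total (X Y : Eff.{u}) (F : X.carrier → Y.carrier → Set ℕ) : Set ℕ :=
  ⋂ x, X.ex x ⇒ᵣ ⋃ y, Y.ex y ⊓ᵣ F x y

/-- `F` is a functional relation from `X` to `Y`. -/
def functional (X Y : Eff.{u}) (F : X.carrier → Y.carrier → Set ℕ) : Set ℕ :=
  strictRel X Y F ⊓ᵣ extRel X Y F ⊓ᵣ singleValued X Y F ⊓ᵣ total X Y F

section rules

variable {ι : Type*} {Γ : ι → List (Set ℕ)} {X Y : Eff.{u}}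

theorem dsymm {a b : ι → X.carrier} (h : Der Γ fun i => X.eq (a i) (b i)) :
    Der Γ fun i => X.eq (b i) (a i) :=
  (((Der.ofValid X.symm).allE a).allE b).mp h

theorem dtrans {a b c : ι → X.carrier} (h : Der Γ fun i => X.eq (a i) (b i))
    (h' : Der Γ fun i => X.eq (b i) (c i)) : Der Γ fun i => X.eq (a i) (c i) :=
  ((((Der.ofValid X.trans).allE a).allE b).allE c).mp (h.andI h')

theorem dleft {a b : ι → X.carrier} (h : Der Γ fun i => X.eq (a i) (b i)) :
    Der Γ fun i => X.ex (a i) := dtrans h (dsymm h)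

theorem dright {a b : ι → X.carrier} (h : Der Γ fun i => X.eq (a i) (b i)) :
    Der Γ fun i => X.ex (b i) := dtrans (dsymm h) h

variable {F : ι → X.carrier → Y.carrier → Set ℕ} {x x' : ι → X.carrier} {y y' : ι → Y.carrier}

theorem fleft (hF : Der Γ fun i => functional X Y (F i)) (h : Der Γ fun i => F i (x i) (y i)) :
    Der Γ fun i => X.ex (x i) :=
  (((hF.fst.allE x).allE y).mp h).fst

theorem fright (hF : Der Γ fun i => functional X Y (F i)) (h : Der Γ fun i => F i (x i) (y i)) :
    Der Γ fun i => Y.ex (y i) :=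
  (((hF.fst.allE x).allE y).mp h).snd

theorem fext (hF : Der Γ fun i => functional X Y (F i)) (hx : Der Γ fun i => X.eq (x' i) (x i))
    (h : Der Γ fun i => F i (x i) (y i)) (hy : Der Γ fun i => Y.eq (y i) (y' i)) :
    Der Γ fun i => F i (x' i) (y' i) :=
  ((((hF.snd.fst.allE x').allE x).allE y).allE y').mp (hx.andI (h.andI hy))

theorem fsv (hF : Der Γ fun i => functional X Y (F i)) (h : Der Γ fun i => F i (x i) (y i))
    (h' : Der Γ fun i => F i (x i) (y' i)) : Der Γ fun i => Y.eq (y i) (y' i) :=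
  (((hF.snd.snd.fst.allE x).allE y).allE y').mp (h.andI h')

theorem ftot (hF : Der Γ fun i => functional X Y (F i)) (h : Der Γ fun i => X.ex (x i)) :
    Der Γ fun i => ⋃ z, Y.ex z ⊓ᵣ F i (x i) z :=
  (hF.snd.snd.snd.allE x).mp h

end rules

/-! ### The category -/

/-- A functional relation from `X` to `Y`. -/
structure FunRel (X Y : Eff.{u}) where
  rel : X.carrier → Y.carrier → Set ℕ
  isFun : Valid (functional X Y rel)

/-- The entailment preorder on functional relations. -/
def FunRel.le {X Y : Eff.{u}} (F G : FunRel X Y) : Prop :=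
  Entails (fun p : X.carrier × Y.carrier => F.rel p.1 p.2) (fun p => G.rel p.1 p.2)

theorem FunRel.le.der {X Y : Eff.{u}} {F G : FunRel X Y} (h : F.le G) {ι : Type*}
    {Γ : ι → List (Set ℕ)} {x : ι → X.carrier} {y : ι → Y.carrier}
    (h' : Der Γ fun i => F.rel (x i) (y i)) : Der Γ fun i => G.rel (x i) (y i) := by
  obtain ⟨n, hn⟩ := h
  have : Entails (fun i => F.rel (x i) (y i)) (fun i => G.rel (x i) (y i)) :=
    ⟨n, Set.mem_iInter.2 fun i => Set.mem_iInter.1 hn (x i, y i)⟩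
  exact Entails.trans h' this

theorem FunRel.le_of_der {X Y : Eff.{u}} {F G : FunRel X Y}
    (h : Der (fun p : X.carrier × Y.carrier => [F.rel p.1 p.2]) fun p => G.rel p.1 p.2) :
    F.le G := entails_iff_der.2 h

theorem FunRel.der {X Y : Eff.{u}} (F : FunRel X Y) {ι : Type*} {Γ : ι → List (Set ℕ)} :
    Der Γ fun _ => functional X Y F.rel := Der.ofValid F.isFun

/-- Two functional relations represent the same morphism when each entails the other. -/
instance FunRel.setoid (X Y : Eff.{u}) : Setoid (FunRel X Y) where
  r F G := F.le G ∧ G.le F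
  iseqv :=
    { refl := fun _ => ⟨FunRel.le_of_der Der.h0, FunRel.le_of_der Der.h0⟩
      symm := fun h => ⟨h.2, h.1⟩
      trans := fun h h' => ⟨Entails.trans h.1 h'.1, Entails.trans h'.2 h.2⟩ }

/-- The identity functional relation. -/
def FunRel.id (X : Eff.{u}) : FunRel X X where
  rel := X.eq
  isFun := by
    refine Der.valid (Der.andI ?_ (Der.andI ?_ (Der.andI ?_ ?_)))
    · exact .allI (.allI (.impI (.andI (dleft .h0) (dright .h0))))
    · exact .allI (.allI (.allI (.allI (.impI
        (dtrans (Der.fst .h0) (dtrans (Der.fst (Der.snd .h0)) (Der.snd (Der.snd .h0))))))))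
    · exact .allI (.allI (.allI (.impI (dtrans (dsymm (Der.fst .h0)) (Der.snd .h0)))))
    · exact .allI (.impI (.exI (fun p => p.2) (.andI .h0 .h0)))

/-- Composition of functional relations (in diagrammatic order). -/
def FunRel.comp {X Y Z : Eff.{u}} (F : FunRel X Y) (G : FunRel Y Z) : FunRel X Z where
  rel x z := ⋃ y, F.rel x y ⊓ᵣ G.rel y z
  isFun := by
    refine Der.valid (Der.andI ?_ (Der.andI ?_ (Der.andI ?_ ?_)))
    · refine .allI (.allI (.impI (Der.exE .h0 ?_)))
      exact .andI (fleft F.der (Der.fst .h0)) (fright G.der (Der.snd .h0))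
    · refine .allI (.allI (.allI (.allI (.impI (Der.exE (Der.fst (Der.snd .h0)) ?_)))))
      refine .exI (fun p => p.2) (.andI ?_ ?_)
      · exact fext F.der (Der.fst .h1) (Der.fst .h0) (fright F.der (Der.fst .h0))
      · exact fext G.der (fleft G.der (Der.snd .h0)) (Der.snd .h0) (Der.snd (Der.snd .h1))
    · refine .allI (.allI (.allI (.impI (Der.exE (Der.fst .h0) (Der.exE (Der.snd .h1) ?_)))))
      exact fsv G.der (Der.snd .h1) (fext G.der (fsv F.der (Der.fst .h1) (Der.fst .h0))
        (Der.snd .h0) (fright G.der (Der.snd .h0)))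
    · refine .allI (.impI (Der.exE (ftot F.der .h0) (Der.exE (ftot G.der (Der.fst .h0)) ?_)))
      exact .exI (fun p => p.2) (.andI (Der.fst .h0)
        (.exI (fun p => p.1.2) (.andI (Der.snd .h1) (Der.snd .h0))))

theorem FunRel.comp_le {X Y Z : Eff.{u}} {F F' : FunRel X Y} {G G' : FunRel Y Z}
    (h : F.le F') (h' : G.le G') : (F.comp G).le (F'.comp G') :=
  FunRel.le_of_der (Der.exE .h0
    (.exI (fun p => p.2) (.andI (h.der (Der.fst .h0)) (h'.der (Der.snd .h0)))))

/-- The effective topos as a category. -/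
instance category : CategoryTheory.Category.{u} Eff.{u} where
  Hom X Y := Quotient (FunRel.setoid X Y)
  id X := ⟦FunRel.id X⟧
  comp := Quotient.map₂ FunRel.comp fun _ _ h _ _ h' =>
    ⟨FunRel.comp_le h.1 h'.1, FunRel.comp_le h.2 h'.2⟩
  id_comp := by
    rintro X Y ⟨F⟩
    refine Quotient.sound ⟨FunRel.le_of_der ?_, FunRel.le_of_der ?_⟩
    · exact Der.exE .h0 (fext F.der (Der.fst .h0) (Der.snd .h0) (fright F.der (Der.snd .h0)))
    · exact .exI (fun p => p.1) (.andI (fleft F.der .h0) .h0)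
  comp_id := by
    rintro X Y ⟨F⟩
    refine Quotient.sound ⟨FunRel.le_of_der ?_, FunRel.le_of_der ?_⟩
    · exact Der.exE .h0 (fext F.der (fleft F.der (Der.fst .h0)) (Der.fst .h0) (Der.snd .h0))
    · exact .exI (fun p => p.2) (.andI .h0 (fright F.der .h0))
  assoc := by
    rintro X Y Z W ⟨F⟩ ⟨G⟩ ⟨H⟩
    refine Quotient.sound ⟨FunRel.le_of_der ?_, FunRel.le_of_der ?_⟩
    · refine Der.exE .h0 (Der.exE (Der.fst .h0) ?_)
      exact .exI (fun p => p.2) (.andI (Der.fst .h0)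
        (.exI (fun p => p.1.2) (.andI (Der.snd .h0) (Der.snd .h1))))
    · refine Der.exE .h0 (Der.exE (Der.snd .h0) ?_)
      exact .exI (fun p => p.2) (.andI
        (.exI (fun p => p.1.2) (.andI (Der.fst .h1) (Der.fst .h0))) (Der.snd .h0))

/-! ### Constant objects, powerobjects, exponentials, subobjects -/

open Classical in
/-- The constant object `∇ S` on a set `S`. -/
def nabla (S : Type u) : Eff.{u} where
  carrier := S
  eq x y := if x = y then Set.univ else ∅
  symm := by
    refine ⟨Encodable.encode Nat.Partrec.Code.id, ?_⟩
    simp only [Set.mem_iInter]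
    intro x y m hm
    exact ⟨m, by simp [app], by simpa [eq_comm] using hm⟩
  trans := by
    refine ⟨Encodable.encode Nat.Partrec.Code.id, ?_⟩
    simp only [Set.mem_iInter]
    rintro x y z m ⟨a, ha, b, hb, rfl⟩
    refine ⟨_, by simp only [app, Denumerable.ofNat_encode, Nat.Partrec.Code.eval_id]; exact Part.mem_some _, ?_⟩
    have hxy : x = y := by by_contra h; simp [h] at ha
    have hyz : y = z := by by_contra h; simp [h] at hb
    simp [hxy, hyz]

/-- The equality predicate of the powerobject of `X`. -/
def powEq (X : Eff.{u}) (A B : X.carrier → Set ℕ) : Set ℕ :=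
  (⋂ x, A x ⇒ᵣ B x) ⊓ᵣ (⋂ x, B x ⇒ᵣ A x) ⊓ᵣ strictPred X A ⊓ᵣ extPred X A

section rules

variable {ι : Type*} {Γ : ι → List (Set ℕ)} {X Y : Eff.{u}}
variable {A B : ι → X.carrier → Set ℕ} {a b : ι → X.carrier}

theorem powEq_fwd (h : Der Γ fun i => powEq X (A i) (B i)) (ha : Der Γ fun i => A i (a i)) :
    Der Γ fun i => B i (a i) :=
  ((Der.fst h).allE a).mp ha

theorem powEq_bwd (h : Der Γ fun i => powEq X (A i) (B i)) (ha : Der Γ fun i => B i (a i)) :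
    Der Γ fun i => A i (a i) :=
  ((Der.fst (Der.snd h)).allE a).mp ha

theorem powEq_strict (h : Der Γ fun i => powEq X (A i) (B i)) (ha : Der Γ fun i => A i (a i)) :
    Der Γ fun i => X.ex (a i) :=
  ((Der.fst (Der.snd (Der.snd h))).allE a).mp ha

theorem powEq_ext (h : Der Γ fun i => powEq X (A i) (B i)) (ha : Der Γ fun i => A i (a i))
    (hab : Der Γ fun i => X.eq (a i) (b i)) : Der Γ fun i => A i (b i) :=
  (((Der.snd (Der.snd (Der.snd h))).allE a).allE b).mp (ha.andI hab)

theorem powEq_symm (h : Der Γ fun i => powEq X (A i) (B i)) :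
    Der Γ fun i => powEq X (B i) (A i) := by
  refine .andI (Der.fst (Der.snd h)) (.andI (Der.fst h) (.andI ?_ ?_)) <;>
    refine Der.cut h ?_
  · exact .allI (.impI (powEq_strict .h1 (powEq_bwd .h1 .h0)))
  · exact .allI (.allI (.impI (powEq_fwd .h1
      (powEq_ext .h1 (powEq_bwd .h1 (Der.fst .h0)) (Der.snd .h0)))))

theorem powEq_trans {C : ι → X.carrier → Set ℕ} (h : Der Γ fun i => powEq X (A i) (B i))
    (h' : Der Γ fun i => powEq X (B i) (C i)) : Der Γ fun i => powEq X (A i) (C i) := by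
  refine .andI ?_ (.andI ?_ (Der.snd (Der.snd h))) <;>
    refine Der.cut h (Der.cut (Der.wk h') ?_)
  · exact .allI (.impI (powEq_fwd .h1 (powEq_fwd .h2 .h0)))
  · exact .allI (.impI (powEq_bwd .h2 (powEq_bwd .h1 .h0)))

end rules

/-- The powerobject of `X`. -/
def pow (X : Eff.{u}) : Eff.{u} where
  carrier := X.carrier → Set ℕ
  eq := powEq X
  symm := Der.valid (.allI (.allI (.impI (powEq_symm .h0))))
  trans := Der.valid (.allI (.allI (.allI (.impI (powEq_trans (Der.fst .h0) (Der.snd .h0))))))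

/-- The membership predicate `a ∈ A`, for `a : X` and `A : pow X`. -/
def mem (X : Eff.{u}) (a : X.carrier) (A : X.pow.carrier) : Set ℕ :=
  X.ex a ⊓ᵣ X.pow.ex A ⊓ᵣ A a

/-- The equality predicate of the exponential `Y ^ X`. -/
def expEq (X Y : Eff.{u}) (F G : X.carrier → Y.carrier → Set ℕ) : Set ℕ :=
  functional X Y F ⊓ᵣ functional X Y G ⊓ᵣ
    (⋂ x, ⋂ y, F x y ⇒ᵣ G x y) ⊓ᵣ (⋂ x, ⋂ y, G x y ⇒ᵣ F x y)

section rules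

variable {ι : Type*} {Γ : ι → List (Set ℕ)} {X Y : Eff.{u}}
variable {F G : ι → X.carrier → Y.carrier → Set ℕ} {x : ι → X.carrier} {y : ι → Y.carrier}

theorem expEq_fwd (h : Der Γ fun i => expEq X Y (F i) (G i)) (hF : Der Γ fun i => F i (x i) (y i)) :
    Der Γ fun i => G i (x i) (y i) :=
  (((Der.fst (Der.snd (Der.snd h))).allE x).allE y).mp hF

theorem expEq_symm (h : Der Γ fun i => expEq X Y (F i) (G i)) :
    Der Γ fun i => expEq X Y (G i) (F i) :=
  .andI (Der.fst (Der.snd h)) (.andI (Der.fst h)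
    (.andI (Der.snd (Der.snd (Der.snd h))) (Der.fst (Der.snd (Der.snd h)))))

theorem expEq_trans {H : ι → X.carrier → Y.carrier → Set ℕ}
    (h : Der Γ fun i => expEq X Y (F i) (G i)) (h' : Der Γ fun i => expEq X Y (G i) (H i)) :
    Der Γ fun i => expEq X Y (F i) (H i) := by
  refine .andI (Der.fst h) (.andI (Der.fst (Der.snd h')) (.andI ?_ ?_)) <;>
    refine Der.cut h (Der.cut (Der.wk h') ?_)
  · exact .allI (.allI (.impI (expEq_fwd .h1 (expEq_fwd .h2 .h0))))
  · exact .allI (.allI (.impI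
      (expEq_fwd (expEq_symm .h2) (expEq_fwd (expEq_symm .h1) .h0))))

end rules

/-- The exponential `Y ^ X`: its elements are relations, which exist to the extent that they are
functional, and which are equal to the extent that they entail each other. -/
def exp (X Y : Eff.{u}) : Eff.{u} where
  carrier := X.carrier → Y.carrier → Set ℕ
  eq := expEq X Y
  symm := Der.valid (.allI (.allI (.impI (expEq_symm .h0))))
  trans := Der.valid (.allI (.allI (.allI (.impI (expEq_trans (Der.fst .h0) (Der.snd .h0))))))

/-- The graph `f(p) = y` of the evaluation map, for `f : Y ^ X`, `p : X` and `y : Y`. -/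
def ev (X Y : Eff.{u}) (f : (exp X Y).carrier) (p : X.carrier) (y : Y.carrier) : Set ℕ :=
  (exp X Y).ex f ⊓ᵣ X.ex p ⊓ᵣ f p y

/-- The equality predicate of the object `{x : X | φ x}`. -/
def sepEq (X : Eff.{u}) (φ : X.carrier → Set ℕ) (x y : X.carrier) : Set ℕ := X.eq x y ⊓ᵣ φ x

section rules

variable {ι : Type*} {Γ : ι → List (Set ℕ)} {X : Eff.{u}} {φ : X.carrier → Set ℕ}
  {a b c : ι → X.carrier}

theorem sepEq_eq (h : Der Γ fun i => sepEq X φ (a i) (b i)) : Der Γ fun i => X.eq (a i) (b i) :=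
  Der.fst h

theorem sepEq_symm (hφ : Valid (extPred X φ)) (h : Der Γ fun i => sepEq X φ (a i) (b i)) :
    Der Γ fun i => sepEq X φ (b i) (a i) :=
  .andI (dsymm (sepEq_eq h))
    ((((Der.ofValid hφ).allE a).allE b).mp (.andI (Der.snd h) (Der.fst h)))

theorem sepEq_left (h : Der Γ fun i => sepEq X φ (a i) (b i)) :
    Der Γ fun i => sepEq X φ (a i) (a i) :=
  .andI (dleft (sepEq_eq h)) (Der.snd h)

theorem sepEq_trans (h : Der Γ fun i => sepEq X φ (a i) (b i))
    (h' : Der Γ fun i => X.eq (b i) (c i)) : Der Γ fun i => sepEq X φ (a i) (c i) :=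
  .andI (dtrans (sepEq_eq h) h') (Der.snd h)

end rules

/-- The object `{x : X | φ x}` given by an extensional predicate `φ` on `X`: an element `x` of it
exists to the extent that `x` exists in `X` and `φ x` holds. -/
def sep (X : Eff.{u}) (φ : X.carrier → Set ℕ) (hφ : Valid (extPred X φ)) : Eff.{u} where
  carrier := X.carrier
  eq := sepEq X φ
  symm := Der.valid (.allI (.allI (.impI (sepEq_symm hφ .h0))))
  trans := Der.valid (.allI (.allI (.allI (.impI
    (sepEq_trans (Der.fst .h0) (sepEq_eq (Der.snd .h0)))))))

/-- The inclusion of `{x : X | φ x}` into `X`, as a functional relation. -/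
def sepRel (X : Eff.{u}) (φ : X.carrier → Set ℕ) (hφ : Valid (extPred X φ)) :
    FunRel (X.sep φ hφ) X where
  rel := sepEq X φ
  isFun := by
    refine Der.valid (Der.andI ?_ (Der.andI ?_ (Der.andI ?_ ?_)))
    · exact .allI (.allI (.impI (.andI (sepEq_left .h0) (dright (sepEq_eq .h0)))))
    · exact .allI (.allI (.allI (.allI (.impI (sepEq_trans (sepEq_trans (Der.fst .h0)
        (sepEq_eq (Der.fst (Der.snd .h0)))) (Der.snd (Der.snd .h0)))))))
    · exact .allI (.allI (.allI (.impI
        (dtrans (dsymm (sepEq_eq (Der.fst .h0))) (sepEq_eq (Der.snd .h0))))))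
    · exact .allI (.impI (.exI (fun p => p.2) (.andI (Der.fst .h0) .h0)))

/-- The inclusion of `{x : X | φ x}` into `X`, as a morphism of the effective topos. -/
def sepι (X : Eff.{u}) (φ : X.carrier → Set ℕ) (hφ : Valid (extPred X φ)) : X.sep φ hφ ⟶ X :=
  Quotient.mk (FunRel.setoid _ _) (sepRel X φ hφ)

theorem sepRel_cancel {X W : Eff.{u}} {φ : X.carrier → Set ℕ} {hφ : Valid (extPred X φ)}
    {F G : FunRel W (X.sep φ hφ)} (h : (F.comp (sepRel X φ hφ)).le (G.comp (sepRel X φ hφ))) :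
    F.le G := by
  refine FunRel.le_of_der ?_
  have key : Der (fun p : W.carrier × (X.sep φ hφ).carrier => [F.rel p.1 p.2])
      fun p => (G.comp (sepRel X φ hφ)).rel p.1 p.2 :=
    h.der (.exI (fun p => p.2) (.andI .h0 (fright F.der .h0)))
  refine Der.exE key ?_
  exact fext G.der (fleft G.der (Der.fst .h0)) (Der.fst .h0) (Der.snd .h0)

instance sepι_mono (X : Eff.{u}) (φ : X.carrier → Set ℕ) (hφ : Valid (extPred X φ)) :
    CategoryTheory.Mono (X.sepι φ hφ) where
  right_cancellation := by
    rintro W ⟨F⟩ ⟨G⟩ h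
    have h' := Quotient.exact h
    exact Quotient.sound ⟨sepRel_cancel h'.1, sepRel_cancel h'.2⟩

/-- The subobject `{x : X | φ x}` of `X` given by an extensional predicate `φ` on `X`. -/
noncomputable def sub (X : Eff.{u}) (φ : X.carrier → Set ℕ) (hφ : Valid (extPred X φ)) :
    CategoryTheory.Subobject X :=
  CategoryTheory.Subobject.mk (X.sepι φ hφ)

/-! ### Posets, chains and discrete subobjects -/

/-- The object `L` with the relation `le` on it is a poset in the effective topos: `le` is strict
and extensional (so that it represents a subobject of `L × L`), and it is reflexive, transitive and
antisymmetric in the internal language. -/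
structure IsPoset (L : Eff.{u}) (le : L.carrier → L.carrier → Set ℕ) : Prop where
  strict : Valid (strictRel L L le)
  ext : Valid (extRel L L le)
  refl : Valid (L.all fun x => le x x)
  trans : Valid (L.all fun x => L.all fun y => L.all fun z => le x y ⊓ᵣ le y z ⇒ᵣ le x z)
  antisymm : Valid (L.all fun x => L.all fun y => le x y ⊓ᵣ le y x ⇒ᵣ L.eq x y)

/-- The statement `∀ x y : L, x ∈ C ∧ y ∈ C ⇒ x ≤ y ∨ y ≤ x`, for `C : pow L`. -/
def chain (L : Eff.{u}) (le : L.carrier → L.carrier → Set ℕ) (C : L.pow.carrier) : Set ℕ :=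
  L.all fun x => L.all fun y => L.mem x C ⊓ᵣ L.mem y C ⇒ᵣ le x y ⊔ᵣ le y x

/-- The object `∇ 2`, where `2 = {0, 1}`. -/
def nablaTwo : Eff.{u} := nabla (ULift.{u} (Fin 2))

/-- The statement `f(p) ∈ A`, that is `∃ y : X, f(p) = y ∧ y ∈ A`, for `f : X ^ (∇ 2)`,
`p : ∇ 2` and `A : pow X`. -/
def evMem (X : Eff.{u}) (f : (exp nablaTwo X).carrier) (p : nablaTwo.{u}.carrier)
    (A : X.pow.carrier) : Set ℕ :=
  X.some fun y => ev nablaTwo X f p y ⊓ᵣ X.mem y A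

/-- The statement `f(p) = f(q)`, for `f : X ^ (∇ 2)` and `p q : ∇ 2`. -/
def evEq (X : Eff.{u}) (f : (exp nablaTwo X).carrier) (p q : nablaTwo.{u}.carrier) : Set ℕ :=
  ⋃ y, ev nablaTwo X f p y ⊓ᵣ ev nablaTwo X f q y

/-- The statement that `A : pow X` is discrete:
`∀ f : X ^ (∇ 2), (∀ p : ∇ 2, f(p) ∈ A) ⇒ (∀ p : ∇ 2, f(p) = f(1))`. -/
def discrete (X : Eff.{u}) (A : X.pow.carrier) : Set ℕ :=
  (exp nablaTwo X).all fun f =>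
    (nablaTwo.all fun p => evMem X f p A) ⇒ᵣ (nablaTwo.all fun p => evEq X f p ⟨1⟩)

section rules

variable {ι : Type*} {Γ : ι → List (Set ℕ)} {X : Eff.{u}}

theorem mem_congr {A B : ι → X.pow.carrier} {a : ι → X.carrier}
    (h : Der Γ fun i => X.pow.eq (A i) (B i)) (ha : Der Γ fun i => X.mem (a i) (B i)) :
    Der Γ fun i => X.mem (a i) (A i) :=
  .andI (Der.fst ha) (.andI (dleft h) (powEq_bwd h (Der.snd (Der.snd ha))))

theorem dall {φ : ι → X.carrier → Set ℕ} (h : Der Γ fun i => X.all (φ i)) (a : ι → X.carrier)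
    (ha : Der Γ fun i => X.ex (a i)) : Der Γ fun i => φ i (a i) :=
  (h.allE a).mp ha

theorem chain_elim {le : X.carrier → X.carrier → Set ℕ} {C : ι → X.pow.carrier}
    {a b : ι → X.carrier} (h : Der Γ fun i => chain X le (C i))
    (ha : Der Γ fun i => X.mem (a i) (C i)) (hb : Der Γ fun i => X.mem (b i) (C i)) :
    Der Γ fun i => le (a i) (b i) ⊔ᵣ le (b i) (a i) :=
  (dall (dall h a (Der.fst ha)) b (Der.fst hb)).mp (.andI ha hb)

theorem discrete_elim {A : ι → X.pow.carrier} {f : ι → (exp nablaTwo X).carrier}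
    (h : Der Γ fun i => discrete X (A i)) (hf : Der Γ fun i => (exp nablaTwo X).ex (f i))
    (hA : Der Γ fun i => nablaTwo.all fun p => evMem X (f i) p (A i)) :
    Der Γ fun i => nablaTwo.all fun p => evEq X (f i) p ⟨1⟩ :=
  (dall h f hf).mp hA

theorem evMem_congr {A B : ι → X.pow.carrier} {f : ι → (exp nablaTwo X).carrier}
    {p : ι → nablaTwo.{u}.carrier} (h : Der Γ fun i => X.pow.eq (A i) (B i))
    (hB : Der Γ fun i => evMem X (f i) (p i) (B i)) :
    Der Γ fun i => evMem X (f i) (p i) (A i) := by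
  refine Der.cut h (Der.exE (Der.wk hB) ?_)
  exact .exI (fun q => q.2) (.andI (Der.fst .h0) (.andI (Der.fst (Der.snd .h0))
    (mem_congr .h1 (Der.snd (Der.snd .h0)))))

end rules

theorem chain_ext (L : Eff.{u}) (le : L.carrier → L.carrier → Set ℕ) :
    Valid (extPred L.pow (chain L le)) := by
  refine Der.valid (.allI (.allI (.impI (.allI (.impI (.allI (.impI (.impI ?_))))))))
  exact chain_elim (Der.fst .h3) (mem_congr (Der.snd .h3) (Der.fst .h0))
    (mem_congr (Der.snd .h3) (Der.snd .h0))

theorem discrete_congr {ι : Type*} {Γ : ι → List (Set ℕ)} {X : Eff.{u}}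
    {A B : ι → X.pow.carrier} (h : Der Γ fun i => X.pow.eq (A i) (B i))
    (hA : Der Γ fun i => discrete X (A i)) : Der Γ fun i => discrete X (B i) := by
  refine .allI (.impI (.impI ?_))
  have hA' := Der.wk (B := fun q : ι × (exp nablaTwo X).carrier =>
      nablaTwo.all fun p => evMem X q.2 p (B q.1)) (Der.wk (B := fun q => (exp nablaTwo X).ex q.2)
    (hA.reindex (Prod.fst : ι × (exp nablaTwo X).carrier → ι)))
  have h' := Der.wk (B := fun q : ι × (exp nablaTwo X).carrier =>
      nablaTwo.all fun p => evMem X q.2 p (B q.1)) (Der.wk (B := fun q => (exp nablaTwo X).ex q.2)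
    (h.reindex (Prod.fst : ι × (exp nablaTwo X).carrier → ι)))
  refine discrete_elim hA' .h1 (.allI (.impI ?_))
  have e1 := Der.wk (B := fun q : (ι × (exp nablaTwo X).carrier) × nablaTwo.{u}.carrier =>
    nablaTwo.ex q.2) (h'.reindex Prod.fst)
  have e2 := dall (Γ := fun q : (ι × (exp nablaTwo X).carrier) × nablaTwo.{u}.carrier =>
      nablaTwo.ex q.2 :: (nablaTwo.all fun p => evMem X q.1.2 p (B q.1.1)) ::
      (exp nablaTwo X).ex q.1.2 :: Γ q.1.1)
    (φ := fun q p => evMem X q.1.2 p (B q.1.1)) Der.h1 (fun q => q.2) Der.h0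
  have e3 := evMem_congr e1 e2
  exact e3

theorem discrete_ext (X : Eff.{u}) : Valid (extPred X.pow (discrete X)) :=
  Der.valid (.allI (.allI (.impI (discrete_congr (Der.snd .h0) (Der.fst .h0)))))

/-- The object of chains in `L`, as a subobject of the powerobject of `L`. -/
noncomputable def chains (L : Eff.{u}) (le : L.carrier → L.carrier → Set ℕ) :
    CategoryTheory.Subobject L.pow :=
  L.pow.sub (chain L le) (chain_ext L le)

/-- The object of discrete subobjects of `X`, as a subobject of the powerobject of `X`. -/
noncomputable def discretes (X : Eff.{u}) : CategoryTheory.Subobject X.pow :=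
  X.pow.sub (discrete X) (discrete_ext X)

end Eff

/-! ### Realizers of disjunctions -/

namespace Realizability

namespace Der

variable {ι P : Type*} {Γ : ι → List (Set ℕ)} {A B C : ι → Set ℕ}

/-! An element of `∇ 2` carries no computational information: every number realizes its existence.
So when all values of `f` lie in a chain, a single number `m`, independent of `p` and `q`, realizes
"`f(p) ≤ f(q)` or `f(q) ≤ f(p)`" for all `p` and `q` at once.

The tag of `m` is therefore also independent of `p` and `q`. If it says "left", the payload realizes
`f(p) ≤ f(q)` for every pair. If it says "right", it realizes `f(q) ≤ f(p)` for every pair, which is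
the same family after swapping `p` and `q`. Either way the payload of `m` uniformly realizes `f(p) ≤
f(q)`; this is `of_uniform_or`. Using that at `(p, 1)` and `(1, p)`, antisymmetry gives `f(p) =
f(1)` (`evEq_of_evLe`).

The whole argument is uniform in the chain and in `f`, so it proves the internal implication. The
inclusion of subobjects then follows formally, by `sub_le_sub`. -/

theorem orI₁ (h : Der Γ A) : Der Γ (fun i => A i ⊔ᵣ B i) := by
  refine Entails.trans h (entails_of_partrec (fun n => Part.some (Nat.pair 0 n))
    (Partrec.nat_iff.1 ?_) fun i m hm => ⟨_, Part.mem_some _, Or.inl ⟨m, hm, rfl⟩⟩)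
  exact (Primrec₂.natPair.comp (Primrec.const 0) Primrec.id).to_comp.partrec

theorem orI₂ (h : Der Γ B) : Der Γ (fun i => A i ⊔ᵣ B i) := by
  refine Entails.trans h (entails_of_partrec (fun n => Part.some (Nat.pair 1 n))
    (Partrec.nat_iff.1 ?_) fun i m hm => ⟨_, Part.mem_some _, Or.inr ⟨m, hm, rfl⟩⟩)
  exact (Primrec₂.natPair.comp (Primrec.const 1) Primrec.id).to_comp.partrec

/-- Disjunction elimination: the program branches on the tag of the realizer. -/
theorem orE (h : Der Γ (fun i => A i ⊔ᵣ B i)) (hA : Der (fun i => A i :: Γ i) C)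
    (hB : Der (fun i => B i :: Γ i) C) : Der Γ C := by
  refine cut h ?_
  obtain ⟨c, hc⟩ := hA.exists_code
  obtain ⟨d, hd⟩ := hB.exists_code
  have hp (c : Nat.Partrec.Code) : Partrec c.eval :=
    Partrec.nat_iff.2 (Nat.Partrec.Code.exists_code.2 ⟨c, rfl⟩)
  have hu₁ : Primrec fun m : ℕ => m.unpair.1 := Primrec.fst.comp Primrec.unpair
  have hu₂ : Primrec fun m : ℕ => m.unpair.2 := Primrec.snd.comp Primrec.unpair
  -- The input is `⟨⟨tag, n⟩, b⟩` with `b` realizing the context; both branches expect `⟨n, b⟩`.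
  have hin : Computable fun m : ℕ => Nat.pair m.unpair.1.unpair.2 m.unpair.2 :=
    (Primrec₂.natPair.comp (hu₂.comp hu₁) hu₂).to_comp
  have htag : Computable fun m : ℕ => decide (m.unpair.1.unpair.1 = 0) :=
    (Primrec.eq.comp (hu₁.comp hu₁) (Primrec.const 0)).decide.to_comp
  refine entails_of_partrec
    (fun m => bif decide (m.unpair.1.unpair.1 = 0)
      then c.eval (Nat.pair m.unpair.1.unpair.2 m.unpair.2)
      else d.eval (Nat.pair m.unpair.1.unpair.2 m.unpair.2))
    (Partrec.nat_iff.1 (Partrec.cond htag ((hp c).comp hin) ((hp d).comp hin))) fun i m hm => ?_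
  obtain ⟨a, ⟨n, hn, rfl⟩ | ⟨n, hn, rfl⟩, b, hb, rfl⟩ := hm
  · simpa using hc i (Nat.pair n b) ⟨n, hn, b, hb, rfl⟩
  · simpa using hd i (Nat.pair n b) ⟨n, hn, b, hb, rfl⟩

/-- A uniform realizer of `R p q ∨ R q p` has one tag that serves `(p, q)` and `(q, p)` at once, so
it yields a uniform realizer of `R p q`. -/
theorem of_uniform_or {R : ι → P → P → Set ℕ}
    (h : Der Γ fun i => ⋂ p, ⋂ q, R i p q ⊔ᵣ R i q p) : Der Γ fun i => ⋂ p, ⋂ q, R i p q := by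
  -- The program just discards the tag: no branching is needed, since the payload is correct in both
  -- cases.
  refine Entails.trans h (entails_of_code Nat.Partrec.Code.right fun i m hm =>
    ⟨m.unpair.2, by simp [Nat.Partrec.Code.eval], ?_⟩)
  have hm' : ∀ p q, m ∈ R i p q ⊔ᵣ R i q p := fun p q =>
    Set.mem_iInter.1 (Set.mem_iInter.1 hm p) q
  refine Set.mem_iInter.2 fun p => Set.mem_iInter.2 fun q => ?_
  obtain ⟨n, hn, h⟩ | ⟨n, hn, h⟩ := hm' p q
  · simpa [h] using hn
  -- With tag 1 at `(p, q)`, the same `m` read at `(q, p)` must again have tag 1, and there the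
  -- right disjunct is `R i p q`.
  · obtain ⟨k, hk, h'⟩ | ⟨k, hk, h'⟩ := hm' q p
    · simpa [h'] using absurd (h.symm.trans h') (by simp [Nat.pair_eq_pair])
    · simpa [h'] using hk

end Der

end Realizability

/-! ### From internal implication to inclusion of subobjects -/

namespace Eff

/-- The subobject given by `φ` is contained in the one given by `ψ` when `φ` implies `ψ` in the
internal language. -/
theorem sub_le_sub {X : Eff.{u}} {φ ψ : X.carrier → Set ℕ} (hφ : Valid (extPred X φ))
    (hψ : Valid (extPred X ψ)) (h : Valid (X.all fun x => φ x ⇒ᵣ ψ x)) :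
    X.sub φ hφ ≤ X.sub ψ hψ := by
  have key {ι : Type u} {Γ : ι → List (Set ℕ)} {a b : ι → X.carrier}
      (hab : Der Γ fun i => sepEq X φ (a i) (b i)) : Der Γ fun i => sepEq X ψ (a i) (b i) :=
    .andI (sepEq_eq hab) ((dall (Der.ofValid h) a (dleft (sepEq_eq hab))).mp (Der.snd hab))
  -- The graph is the relation that also represents the inclusion into `X`, so the triangle over `X`
  -- commutes; `key` supplies the equality of the new codomain.
  let G : FunRel (X.sep φ hφ) (X.sep ψ hψ) :=
    { rel := sepEq X φ
      isFun := by
        refine Der.valid (Der.andI ?_ (Der.andI ?_ (Der.andI ?_ ?_)))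
        · exact .allI (.allI (.impI (.andI (sepEq_left .h0)
            (key (sepEq_left (sepEq_symm hφ .h0))))))
        · exact .allI (.allI (.allI (.allI (.impI (sepEq_trans (sepEq_trans (Der.fst .h0)
            (sepEq_eq (Der.fst (Der.snd .h0)))) (sepEq_eq (Der.snd (Der.snd .h0))))))))
        · exact .allI (.allI (.allI (.impI (key (sepEq_trans (sepEq_symm hφ (Der.fst .h0))
            (sepEq_eq (Der.snd .h0)))))))
        · exact .allI (.impI (.exI (fun p => p.2) (.andI (key .h0) .h0))) }
  refine CategoryTheory.Subobject.mk_le_mk_of_comm (Quotient.mk (FunRel.setoid _ _) G)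
    (Quotient.sound ⟨FunRel.le_of_der (Der.exE .h0 ?_), FunRel.le_of_der ?_⟩)
  · exact sepEq_trans (Der.fst .h0) (sepEq_eq (Der.snd .h0))
  · exact .exI (fun p => p.1) (.andI (sepEq_left .h0) (key .h0))

/-! ### Values of maps from `∇ 2` and their comparison -/

variable {ι : Type*} {Γ : ι → List (Set ℕ)}

/-- The existence predicate of `∇ 2` is all of `ℕ`, so a constant realizer works for every `p`. This
lets quantifiers over `∇ 2` be treated as plain intersections. -/
theorem nablaTwo_ex (p : ι → nablaTwo.{u}.carrier) : Der Γ fun i => nablaTwo.ex (p i) := by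
  have h : (fun i => nablaTwo.ex (p i)) = fun _ => Set.univ := by
    funext i
    exact if_pos rfl
  rw [h]
  exact Der.ofValid ⟨0, trivial⟩

/-- The statement `f(p) ≤ f(q)`, for `f : L ^ (∇ 2)` and `p q : ∇ 2`. -/
def evLe (L : Eff.{u}) (le : L.carrier → L.carrier → Set ℕ) (f : (exp nablaTwo L).carrier)
    (p q : nablaTwo.{u}.carrier) : Set ℕ :=
  ⋃ y, ⋃ z, ev nablaTwo L f p y ⊓ᵣ ev nablaTwo L f q z ⊓ᵣ le y z

variable {L : Eff.{u}} {le : L.carrier → L.carrier → Set ℕ}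

theorem ev_ex {f : ι → (exp nablaTwo L).carrier} {p : ι → nablaTwo.{u}.carrier}
    {y : ι → L.carrier} (h : Der Γ fun i => ev nablaTwo L (f i) (p i) (y i)) :
    Der Γ fun i => L.ex (y i) :=
  fright (Der.fst (Der.fst h)) (Der.snd (Der.snd h))

theorem ev_unique {f : ι → (exp nablaTwo L).carrier} {p : ι → nablaTwo.{u}.carrier}
    {y z : ι → L.carrier} (h : Der Γ fun i => ev nablaTwo L (f i) (p i) (y i))
    (h' : Der Γ fun i => ev nablaTwo L (f i) (p i) (z i)) :
    Der Γ fun i => L.eq (y i) (z i) :=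
  fsv (Der.fst (Der.fst h)) (Der.snd (Der.snd h)) (Der.snd (Der.snd h'))

theorem ev_congr {f : ι → (exp nablaTwo L).carrier} {p : ι → nablaTwo.{u}.carrier}
    {y z : ι → L.carrier} (h : Der Γ fun i => ev nablaTwo L (f i) (p i) (y i))
    (hyz : Der Γ fun i => L.eq (y i) (z i)) :
    Der Γ fun i => ev nablaTwo L (f i) (p i) (z i) :=
  .andI (Der.fst h) (.andI (Der.fst (Der.snd h))
    (fext (Der.fst (Der.fst h)) (Der.fst (Der.snd h)) (Der.snd (Der.snd h)) hyz))

/-- The chain condition is applied to values of `f` at `p` and `q`. Hiding these values under the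
existentials of `evLe` leaves a disjunction in `p` and `q` alone, with the swap symmetry that
`of_uniform_or` needs. -/
theorem evLe_or_evLe {C : ι → L.pow.carrier} {f : ι → (exp nablaTwo L).carrier}
    {p q : ι → nablaTwo.{u}.carrier} (hC : Der Γ fun i => chain L le (C i))
    (hp : Der Γ fun i => evMem L (f i) (p i) (C i))
    (hq : Der Γ fun i => evMem L (f i) (q i) (C i)) :
    Der Γ fun i => evLe L le (f i) (p i) (q i) ⊔ᵣ evLe L le (f i) (q i) (p i) := by
  -- Each existential elimination enlarges the index type; hypotheses placed in the context follow
  -- it automatically. Below, `j.1.2` is the value at `p` and `j.2` the value at `q`.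
  refine Der.cut hC (Der.cut (Der.wk hq) (Der.exE (Der.wk (Der.wk hp)) (Der.exE .h1 ?_)))
  refine Der.orE (chain_elim .h3 (Der.snd (Der.snd .h1)) (Der.snd (Der.snd .h0))) ?_ ?_
  · exact .orI₁ (.exI (fun j => j.1.2) (.exI (fun j => j.2)
      (.andI (Der.fst (Der.snd .h2)) (.andI (Der.fst (Der.snd .h1)) .h0))))
  · exact .orI₂ (.exI (fun j => j.2) (.exI (fun j => j.1.2)
      (.andI (Der.fst (Der.snd .h1)) (.andI (Der.fst (Der.snd .h2)) .h0))))

/-- The two inequalities come with separate witnesses for the same values of `f`. Single-valuedness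
identifies them, extensionality of `le` moves the second inequality onto `y` and `z`, and
antisymmetry applies. -/
theorem evEq_of_ev_le (hL : IsPoset L le) {f : ι → (exp nablaTwo L).carrier}
    {p q : ι → nablaTwo.{u}.carrier} {y z z' y' : ι → L.carrier}
    (h : Der Γ fun i => ev nablaTwo L (f i) (p i) (y i) ⊓ᵣ ev nablaTwo L (f i) (q i) (z i) ⊓ᵣ
      le (y i) (z i))
    (h' : Der Γ fun i => ev nablaTwo L (f i) (q i) (z' i) ⊓ᵣ ev nablaTwo L (f i) (p i) (y' i) ⊓ᵣ
      le (z' i) (y' i)) :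
    Der Γ fun i => evEq L (f i) (p i) (q i) := by
  have hy := Der.fst h
  have hz := Der.fst (Der.snd h)
  have hzz' := ev_unique hz (Der.fst h')
  have hy'y := ev_unique (Der.fst (Der.snd h')) hy
  have hzy : Der Γ fun i => le (z i) (y i) :=
    (((((Der.ofValid hL.ext).allE z).allE z').allE y').allE y).mp
      (hzz'.andI ((Der.snd (Der.snd h')).andI hy'y))
  have heq : Der Γ fun i => L.eq (y i) (z i) :=
    (dall (dall (Der.ofValid hL.antisymm) y (ev_ex hy)) z (ev_ex hz)).mp
      ((Der.snd (Der.snd h)).andI hzy)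
  -- The common value is `y`: the value `z` at `q` is replaced by the equal `y`.
  exact .exI y (hy.andI (ev_congr hz (dsymm heq)))

theorem evEq_of_evLe (hL : IsPoset L le) {f : ι → (exp nablaTwo L).carrier}
    {p q : ι → nablaTwo.{u}.carrier} (h : Der Γ fun i => evLe L le (f i) (p i) (q i))
    (h' : Der Γ fun i => evLe L le (f i) (q i) (p i)) :
    Der Γ fun i => evEq L (f i) (p i) (q i) := by
  refine Der.cut h' (Der.exE (Der.wk h) (Der.exE .h0 (Der.exE .h2 (Der.exE .h0 ?_))))
  exact evEq_of_ev_le hL .h2 .h0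

/-! ### Uniformity over `∇ 2` and the conclusion -/

theorem evMem_of_all {C : ι → L.pow.carrier} {f : ι → (exp nablaTwo L).carrier}
    (h : Der Γ fun i => nablaTwo.all fun p => evMem L (f i) p (C i))
    (p : ι → nablaTwo.{u}.carrier) : Der Γ fun i => evMem L (f i) (p i) (C i) :=
  dall (φ := fun i p => evMem L (f i) p (C i)) h p (nablaTwo_ex p)

/-- The points `p` and `q` may vary with `κ` while the context sees only `k j` and contains no added
realizers for them. This independence makes the disjunction uniform in `p` and `q`. -/
theorem evLe_or_evLe_of_all {κ : Type*} {C : ι → L.pow.carrier} {f : ι → (exp nablaTwo L).carrier}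
    (hC : Der Γ fun i => chain L le (C i))
    (hf : Der Γ fun i => nablaTwo.all fun p => evMem L (f i) p (C i)) (k : κ → ι)
    (p q : κ → nablaTwo.{u}.carrier) :
    Der (fun j => Γ (k j)) fun j =>
      evLe L le (f (k j)) (p j) (q j) ⊔ᵣ evLe L le (f (k j)) (q j) (p j) := by
  have hf' := hf.reindex k
  have hmem (r : κ → nablaTwo.{u}.carrier) :
      Der (fun j => Γ (k j)) fun j => evMem L (f (k j)) (r j) (C (k j)) :=
    evMem_of_all (C := fun j => C (k j)) (f := fun j => f (k j)) hf' r
  exact evLe_or_evLe (C := fun j => C (k j)) (f := fun j => f (k j)) (hC.reindex k)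
    (hmem p) (hmem q)

theorem evLe_of_all {κ : Type*} {f : ι → (exp nablaTwo L).carrier}
    (h : Der Γ fun i => ⋂ p, ⋂ q, evLe L le (f i) p q) (k : κ → ι)
    (p q : κ → nablaTwo.{u}.carrier) :
    Der (fun j => Γ (k j)) fun j => evLe L le (f (k j)) (p j) (q j) := by
  have h₀ := h.reindex k
  have h₁ : Der (fun j => Γ (k j)) fun j => ⋂ q, evLe L le (f (k j)) (p j) q :=
    Der.allE (B := fun j p => ⋂ q, evLe L le (f (k j)) p q) h₀ p
  exact Der.allE (B := fun j q => evLe L le (f (k j)) (p j) q) h₁ q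

theorem evEq_of_chain (hL : IsPoset L le) {C : ι → L.pow.carrier}
    {f : ι → (exp nablaTwo L).carrier} (hC : Der Γ fun i => chain L le (C i))
    (hf : Der Γ fun i => nablaTwo.all fun p => evMem L (f i) p (C i)) :
    Der Γ fun i => nablaTwo.all fun p => evEq L (f i) p ⟨1⟩ := by
  have hor := evLe_or_evLe_of_all hC hf
    (fun j : (ι × nablaTwo.{u}.carrier) × nablaTwo.{u}.carrier => j.1.1)
    (fun j => j.1.2) (fun j => j.2)
  -- Bare intersections, with no existence guard on `p` or `q`: one realizer, hence one tag, serves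
  -- all pairs.
  have hle : Der Γ fun i => ⋂ p, ⋂ q, evLe L le (f i) p q :=
    Der.of_uniform_or (R := fun i p q => evLe L le (f i) p q) (.allI (.allI hor))
  -- The uniform inequality is used at `(p, 1)` and at `(1, p)`.
  have heq : Der (fun j : ι × nablaTwo.{u}.carrier => Γ j.1) fun j => evEq L (f j.1) j.2 ⟨1⟩ :=
    evEq_of_evLe hL (evLe_of_all hle _ _ _) (evLe_of_all hle _ _ _)
  exact .allI (.impI (Der.wk heq))

/-- Every chain in a poset is discrete, in the internal language. -/
theorem discrete_of_chain (hL : IsPoset L le) :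
    Valid (L.pow.all fun C => chain L le C ⇒ᵣ discrete L C) := by
  refine Der.valid (.allI (.impI (.impI (.allI (.impI (.impI ?_))))))
  let Γ (i : (Unit × L.pow.carrier) × (exp nablaTwo L).carrier) : List (Set ℕ) :=
    [nablaTwo.all fun p => evMem L i.2 p i.1.2, (exp nablaTwo L).ex i.2, chain L le i.1.2,
      L.pow.ex i.1.2]
  have hC : Der Γ fun i => chain L le i.1.2 := .h2
  have hf : Der Γ fun i => nablaTwo.all fun p => evMem L i.2 p i.1.2 := .h0
  have h := evEq_of_chain hL hC hf
  exact h

end Eff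

theorem mainTheorem4 (L : Eff.{u}) (le : L.carrier → L.carrier → Set ℕ)
    (hL : Eff.IsPoset L le) :
    Valid (L.pow.all fun C => Eff.chain L le C ⇒ᵣ Eff.discrete L C) ∧
      Eff.chains L le ≤ Eff.discretes L :=
  ⟨Eff.discrete_of_chain hL, Eff.sub_le_sub _ _ (Eff.discrete_of_chain hL)⟩
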